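/- There are a constant $\kappa>0$ and, for every integer $n\ge 1$, two nonempty families $\mathcal S_0=\mathcal S_0(n)$ and $\mathcal S_1=\mathcal S_1(n)$ of triples of nonempty subsets of $\{0,1\}^n$ such that $$|A\cap B\cap C|/2^n\ge \tfrac1{16}\ \text{ for all }(A,B,C)\in\mathcal S_0,\qquad |A\cap B\cap C|/2^n=0\ \text{ for all }(A,B,C)\in\mathcal S_1,$$ and yet any quantum algorithm distinguishing the two families from copies of their subset states requires $\Omega(2^{n/2})$ copies of $|A\rangle$, $|B\rangle$ or $|C\rangle$. Here the subset state of a nonempty $S\subseteq\{0,1\}^n$ is $|S\rangle=|S|^{-1/2}\sum_{x\in S}|x\rangle$, and the lower bound means the following: let $a,b,c\ge 0$ be integers and suppose that there is a two-outcome quantum measurement $\{E,I-E\}$ ($0\le E\le I$) on $|A\rangle^{\otimes a}\otimes|B\rangle^{\otimes b}\otimes|C\rangle^{\otimes c}$ that has outcome $E$ with probability at least $2/3$ for every $(A,B,C)\in\mathcal S_0$ and outcome $I-E$ with probability at least $2/3$ for every $(A,B,C)\in\mathcal S_1$; then $\max(a,b,c)\ge\kappa\,2^{n/2}$. -/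

import Mathlib

open scoped ComplexOrder

/-- The Boolean hypercube `{0,1}^n`. -/
abbrev BitString (n : ℕ) : Type := Fin n → Bool

/-- Ordered triples `(A, B, C)` of subsets of `{0,1}^n`. -/
abbrev SetTriple (n : ℕ) : Type :=
  Finset (BitString n) × Finset (BitString n) × Finset (BitString n)

/-- The fractional size `|A ∩ B ∩ C| / 2^n` of the triple intersection. -/
noncomputable def tripleIntersectionDensity {n : ℕ} (T : SetTriple n) : ℝ :=
  ((T.1 ∩ T.2.1 ∩ T.2.2).card : ℝ) / 2 ^ n

/-- The subset state `|S⟩ = |S|^{-1/2} ∑_{x ∈ S} |x⟩`, as the vector of its amplitudes in the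
computational basis. It is a unit vector when `S` is nonempty. -/
noncomputable def subsetState {n : ℕ} (S : Finset (BitString n)) : BitString n → ℂ :=
  fun x => if x ∈ S then ((1 / Real.sqrt (S.card : ℝ) : ℝ) : ℂ) else 0

/-- The `t`-fold tensor power `|ψ⟩^{⊗t}`, in the product basis. -/
def tensorPow {ι : Type*} (ψ : ι → ℂ) (t : ℕ) : (Fin t → ι) → ℂ :=
  fun x => ∏ i, ψ (x i)

/-- The tensor product `|φ⟩ ⊗ |ψ⟩`, in the product basis. -/
def tensorProd {ι κ : Type*} (φ : ι → ℂ) (ψ : κ → ℂ) : ι × κ → ℂ :=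
  fun p => φ p.1 * ψ p.2

/-- Index set of the computational basis of `a + b + c` registers of `n` qubits each. -/
abbrev CopyBasis (n a b c : ℕ) : Type :=
  (Fin a → BitString n) × (Fin b → BitString n) × (Fin c → BitString n)

/-- The joint state `|A⟩^{⊗a} ⊗ |B⟩^{⊗b} ⊗ |C⟩^{⊗c}` for `T = (A, B, C)`. -/
noncomputable def copiesState {n : ℕ} (T : SetTriple n) (a b c : ℕ) : CopyBasis n a b c → ℂ :=
  tensorProd (tensorPow (subsetState T.1) a)
    (tensorProd (tensorPow (subsetState T.2.1) b) (tensorPow (subsetState T.2.2) c))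

/-- `E` is the "accept" element of a two-outcome quantum measurement `{E, 1 - E}` (a POVM).
Every quantum algorithm with a one-bit output acting on the registers indexed by `ι`, with
arbitrary ancillas, entangling operations and intermediate measurements, induces one. -/
structure IsEffect {ι : Type*} [Fintype ι] [DecidableEq ι] (E : Matrix ι ι ℂ) : Prop where
  posSemidef : E.PosSemidef
  compl_posSemidef : (1 - E).PosSemidef

/-- The acceptance probability `⟨ψ| E |ψ⟩` of the measurement `{E, 1 - E}` on the state `|ψ⟩`. -/
noncomputable def acceptProb {ι : Type*} [Fintype ι] (E : Matrix ι ι ℂ) (ψ : ι → ℂ) : ℝ :=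
  (star ψ ⬝ᵥ Matrix.mulVec E ψ).re

/-- The families `S₀` and `S₁` can be distinguished, with success probability at least `2/3` on
every member of either family, by a quantum algorithm that is given `a` copies of `|A⟩`,
`b` copies of `|B⟩` and `c` copies of `|C⟩` (accepting means answering `S₀`). -/
def DistinguishableFromCopies {n : ℕ} (S₀ S₁ : Set (SetTriple n)) (a b c : ℕ) : Prop :=
  ∃ E : Matrix (CopyBasis n a b c) (CopyBasis n a b c) ℂ, IsEffect E ∧
    (∀ T ∈ S₀, 2 / 3 ≤ acceptProb E (copiesState T a b c)) ∧
    (∀ T ∈ S₁, 2 / 3 ≤ 1 - acceptProb E (copiesState T a b c))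

/-! Split the cube into four-point blocks, and in each block translate the sets `u = 1`, `v = 1`, `u
+ v = s` of F_2^2 by a mask. All three meet in one point per block if `s = 0` and nowhere if `s =
1`, yet any two of them look the same for both `s` up to a change of mask. An entry of the density
matrix is indexed by two tuples. If each tuple meets every block at most once, a block carries at
most two of the three labels, so a mask shift exchanges the two values of `s` (`exists_mask_shift`),
and the entries averaged over masks agree (`sum_copiesState_correlation`). The remaining tuples have
mass at most `(a+b+c)^2 / 2^m` by a birthday bound (`sum_prod_not_injective_le`), so fewer than
order `2^(m/2)` copies cannot separate the averages. -/

/-! ### Masked triples and their intersections -/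

/-- The index of the four-point block containing `x`: its bits after the first two. -/
def blockIndex {m : ℕ} (x : BitString (m + 2)) : BitString m := fun i => x i.succ.succ

/-- The tests defining the three sets, in terms of the two masked bits. -/
def maskedTest (s : Bool) : Fin 3 → Bool → Bool → Bool
  | 0, u, _ => u
  | 1, _, v => v
  | 2, u, v => (u ^^ v) == s

/-- The set of points of the cube passing a test, with mask `r`. -/
def maskedSet {m : ℕ} (r : BitString m → Bool × Bool) (s : Bool) (l : Fin 3) :
    Finset (BitString (m + 2)) :=
  Finset.univ.filter fun x =>
    maskedTest s l (x 0 ^^ (r (blockIndex x)).1) (x 1 ^^ (r (blockIndex x)).2) = true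

/-- The triple of sets with mask `r`, of empty intersection if and only if `s` holds. -/
def maskedTriple {m : ℕ} (r : BitString m → Bool × Bool) (s : Bool) : SetTriple (m + 2) :=
  (maskedSet r s 0, maskedSet r s 1, maskedSet r s 2)

theorem sum_bitString_blocks {R : Type*} [AddCommMonoid R] {m : ℕ}
    (F : BitString (m + 2) → R) :
    ∑ x, F x = ∑ w : BitString m, ∑ p : Bool × Bool,
      F (Fin.cons p.1 (Fin.cons p.2 w : BitString (m + 1))) := by
  let e : BitString (m + 2) ≃ BitString m × (Bool × Bool) :=
    { toFun := fun x => (blockIndex x, (x 0, x 1))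
      invFun := fun p => Fin.cons p.2.1 (Fin.cons p.2.2 p.1 : BitString (m + 1))
      left_inv := fun x => by
        funext i
        refine Fin.cases rfl (fun i => ?_) i
        exact Fin.cases rfl (fun _ => rfl) i
      right_inv := fun _ => rfl }
  rw [← e.symm.sum_comp, Fintype.sum_prod_type]
  rfl

@[simp] theorem blockIndex_cons {m : ℕ} (p q : Bool) (w : BitString m) :
    blockIndex (Fin.cons p (Fin.cons q w : BitString (m + 1)) : BitString (m + 2)) = w := rfl

theorem sum_maskedSet_block {m : ℕ} (r : BitString m → Bool × Bool) (s : Bool) (l : Fin 3)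
    (w : BitString m) (t : ℝ) :
    ∑ x, (if blockIndex x = w then (if x ∈ maskedSet r s l then t else 0) else 0) = 2 * t := by
  rw [sum_bitString_blocks, Finset.sum_eq_single w]
  · simp only [maskedSet, Finset.mem_filter, Finset.mem_univ, true_and, blockIndex_cons, if_true,
      Fin.cons_zero, Fin.cons_one, Fintype.sum_prod_type, Fintype.sum_bool]
    rcases r w with ⟨r₁, r₂⟩
    fin_cases l <;> cases s <;> cases r₁ <;> cases r₂ <;> simp [maskedTest] <;> ring
  · intro v _ hv
    simp [hv]
  · simp

theorem card_maskedSet {m : ℕ} (r : BitString m → Bool × Bool) (s : Bool) (l : Fin 3) :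
    ((maskedSet r s l).card : ℝ) = 2 * 2 ^ m := by
  have h : ((maskedSet r s l).card : ℝ) = ∑ w : BitString m, ∑ x,
      (if blockIndex x = w then (if x ∈ maskedSet r s l then (1 : ℝ) else 0) else 0) := by
    rw [Finset.sum_comm]
    simp
  rw [h]
  simp [sum_maskedSet_block]
  ring

theorem maskedSet_nonempty {m : ℕ} (r : BitString m → Bool × Bool) (s : Bool) (l : Fin 3) :
    (maskedSet r s l).Nonempty := by
  rw [← Finset.card_pos]
  have := card_maskedSet r s l
  have h : (0 : ℝ) < (maskedSet r s l).card := by rw [this]; positivity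
  exact_mod_cast h

theorem density_maskedTriple_false {m : ℕ} (r : BitString m → Bool × Bool) :
    tripleIntersectionDensity (maskedTriple r false) = 1 / 4 := by
  have h : (((maskedSet r false 0 ∩ maskedSet r false 1 ∩ maskedSet r false 2).card : ℕ) : ℝ)
      = 2 ^ m := by
    have hx : ∀ (w : BitString m), ∑ p : Bool × Bool,
        (if (Fin.cons p.1 (Fin.cons p.2 w : BitString (m + 1)) : BitString (m + 2)) ∈
          maskedSet r false 0 ∩ maskedSet r false 1 ∩ maskedSet r false 2 then (1 : ℝ) else 0)
        = 1 := by
      intro w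
      simp only [maskedSet, Finset.mem_inter, Finset.mem_filter, Finset.mem_univ, true_and,
        blockIndex_cons, Fin.cons_zero, Fin.cons_one, Fintype.sum_prod_type, Fintype.sum_bool]
      rcases r w with ⟨r₁, r₂⟩
      cases r₁ <;> cases r₂ <;> simp [maskedTest]
    have hc := sum_bitString_blocks fun x : BitString (m + 2) =>
      if x ∈ maskedSet r false 0 ∩ maskedSet r false 1 ∩ maskedSet r false 2
        then (1 : ℝ) else 0
    simp only [hx, Finset.sum_boole, Finset.filter_univ_mem] at hc
    rw [hc]
    simp
  unfold tripleIntersectionDensity maskedTriple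
  rw [h, pow_add]
  field_simp
  norm_num

theorem density_maskedTriple_true {m : ℕ} (r : BitString m → Bool × Bool) :
    tripleIntersectionDensity (maskedTriple r true) = 0 := by
  have h : maskedSet r true 0 ∩ maskedSet r true 1 ∩ maskedSet r true 2 = ∅ := by
    ext x
    simp only [maskedSet, Finset.mem_inter, Finset.mem_filter, Finset.mem_univ, true_and,
      Finset.notMem_empty, iff_false]
    simp only [maskedTest]
    rintro ⟨⟨h₁, h₂⟩, h₃⟩
    rw [h₁, h₂] at h₃
    exact absurd h₃ (by decide)
  simp [tripleIntersectionDensity, maskedTriple, h]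

/-! ### Exchanging the two values of `s` -/

/-- The mask shift that trades the two values of `s` on the blocks met by a pair of
labelled tuples. -/
theorem exists_mask_shift {m : ℕ} {P : Type*} (lab : P → Fin 3) (k k' : P → BitString (m + 2))
    (hk : Function.Injective fun p => blockIndex (k p))
    (hk' : Function.Injective fun p => blockIndex (k' p)) :
    ∃ d : BitString m → Bool × Bool, ∀ r : BitString m → Bool × Bool, ∀ p,
      (k p ∈ maskedSet (fun w => ((r w).1 ^^ (d w).1, (r w).2 ^^ (d w).2)) true (lab p) ↔
        k p ∈ maskedSet r false (lab p)) ∧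
      (k' p ∈ maskedSet (fun w => ((r w).1 ^^ (d w).1, (r w).2 ^^ (d w).2)) true (lab p) ↔
        k' p ∈ maskedSet r false (lab p)) := by
  classical
  let O : Fin 3 → BitString m → Prop := fun l w =>
    ∃ p, lab p = l ∧ (blockIndex (k p) = w ∨ blockIndex (k' p) = w)
  -- Pigeonhole: three labels would need three registers in one block, but each of the two tuples
  -- supplies at most one.
  have hO : ∀ w, O 0 w → O 1 w → O 2 w → False := by
    rintro w ⟨p, hp, h₀⟩ ⟨q, hq, h₁⟩ ⟨t, ht, h₂⟩
    have hpq : p ≠ q := by rintro rfl; simp [hp] at hq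
    have hpt : p ≠ t := by rintro rfl; simp [hp] at ht
    have hqt : q ≠ t := by rintro rfl; simp [hq] at ht
    have key : ∀ {i j : P}, i ≠ j → ¬ (blockIndex (k i) = w ∧ blockIndex (k j) = w) :=
      fun hij h => hij (hk (h.1.trans h.2.symm))
    have key' : ∀ {i j : P}, i ≠ j → ¬ (blockIndex (k' i) = w ∧ blockIndex (k' j) = w) :=
      fun hij h => hij (hk' (h.1.trans h.2.symm))
    have := key hpq; have := key hpt; have := key hqt
    have := key' hpq; have := key' hpt; have := key' hqt
    tauto
  -- Flipping either mask bit flips the test of label 2; flip the one that leaves the other label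
  -- present unaffected.
  let d : BitString m → Bool × Bool := fun w =>
    if O 2 w then (if O 0 w then (false, true) else (true, false)) else (false, false)
  have main : ∀ (r : BitString m → Bool × Bool) (x : BitString (m + 2)) (l : Fin 3),
      O l (blockIndex x) →
      (x ∈ maskedSet (fun w => ((r w).1 ^^ (d w).1, (r w).2 ^^ (d w).2)) true l ↔
        x ∈ maskedSet r false l) := by
    intro r x l hl
    simp only [maskedSet, Finset.mem_filter, Finset.mem_univ, true_and, d]
    have hw := hO (blockIndex x)
    generalize blockIndex x = w at *
    rcases r w with ⟨r₁, r₂⟩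
    generalize x 0 = x₀
    generalize x 1 = x₁
    fin_cases l
    · by_cases h₂ : O 2 w
      · simp [maskedTest, h₂, show O 0 w from hl]
      · simp [maskedTest, h₂]
    · by_cases h₂ : O 2 w
      · have h₀ : ¬ O 0 w := fun h₀ => hw h₀ hl h₂
        simp [maskedTest, h₂, h₀]
      · simp [maskedTest, h₂]
    · have h₂ : O 2 w := hl
      by_cases h₀ : O 0 w <;> simp only [h₂, h₀, if_true, if_false, maskedTest] <;>
        revert x₀ x₁ r₁ r₂ <;> decide
  exact ⟨d, fun r p => ⟨main r _ _ ⟨p, rfl, Or.inl rfl⟩, main r _ _ ⟨p, rfl, Or.inr rfl⟩⟩⟩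

/-! ### Birthday bound for product weights -/

/-- In a product of weights with uniform block marginals, two coordinates fall into the same
block with the collision probability of the uniform distribution. -/
theorem sum_prod_collision {P X W : Type*} [Fintype P] [DecidableEq P] [Fintype X] [Fintype W]
    [DecidableEq W] (g : X → W) (μ : P → X → ℝ) (δ : ℝ)
    (hμ : ∀ p w, ∑ x, (if g x = w then μ p x else 0) = δ) (hδ : Fintype.card W * δ = 1)
    {p q : P} (hpq : p ≠ q) :
    ∑ k : P → X, (if g (k p) = g (k q) then ∏ i, μ i (k i) else 0) = δ := by
  have hone : ∀ i, ∑ x, μ i x = 1 := by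
    intro i
    have : ∑ x, μ i x = ∑ w, ∑ x, (if g x = w then μ i x else 0) := by
      rw [Finset.sum_comm]; simp
    rw [this]; simpa [hμ] using hδ
  -- Summing over the common block `w` makes each term a product over coordinates.
  have hsplit : ∀ k : P → X, (if g (k p) = g (k q) then ∏ i, μ i (k i) else 0) =
      ∑ w, ∏ i, (if i = p ∨ i = q then (if g (k i) = w then μ i (k i) else 0)
        else μ i (k i)) := by
    intro k
    have hw : ∀ w, ∏ i, (if i = p ∨ i = q then (if g (k i) = w then μ i (k i) else 0)
        else μ i (k i)) = if g (k q) = w then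
          (if g (k p) = g (k q) then ∏ i, μ i (k i) else 0) else 0 := by
      intro w
      by_cases h₁ : g (k q) = w
      · by_cases h₂ : g (k p) = g (k q)
        · rw [if_pos h₁, if_pos h₂]
          refine Finset.prod_congr rfl fun i _ => ?_
          split_ifs with hi hgi
          · rfl
          · rcases hi with rfl | rfl
            · exact absurd (h₂.trans h₁) hgi
            · exact absurd h₁ hgi
          · rfl
        · rw [if_pos h₁, if_neg h₂]
          refine Finset.prod_eq_zero (Finset.mem_univ p) ?_
          rw [if_pos (Or.inl rfl), if_neg (fun h => h₂ (h.trans h₁.symm))]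
      · rw [if_neg h₁]
        refine Finset.prod_eq_zero (Finset.mem_univ q) ?_
        rw [if_pos (Or.inr rfl), if_neg h₁]
    simp_rw [hw]
    simp
  simp_rw [hsplit]
  rw [Finset.sum_comm]
  have hin : ∀ w : W, ∑ k : P → X, ∏ i, (if i = p ∨ i = q then
      (if g (k i) = w then μ i (k i) else 0) else μ i (k i)) = δ * δ := by
    intro w
    rw [← Fintype.prod_sum (fun i x => if i = p ∨ i = q then
      (if g x = w then μ i x else 0) else μ i x)]
    have : ∀ i, ∑ x, (if i = p ∨ i = q then (if g x = w then μ i x else 0) else μ i x) =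
        if i ∈ ({p, q} : Finset P) then δ else 1 := by
      intro i
      by_cases hi : i = p ∨ i = q
      · simp [hi, hμ]
      · simp [hi, hone]
    simp_rw [this]
    rw [Finset.prod_ite_mem, Finset.univ_inter, Finset.prod_pair hpq]
  simp_rw [hin]
  rw [Finset.sum_const, Finset.card_univ, nsmul_eq_mul, ← mul_assoc, hδ, one_mul]

/-- Union bound over ordered pairs of coordinates. -/
theorem sum_prod_not_injective_le {P X W : Type*} [Fintype P] [DecidableEq P] [Fintype X]
    [Fintype W] [DecidableEq W] (g : X → W) (μ : P → X → ℝ) (δ : ℝ)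
    (hnn : ∀ p x, 0 ≤ μ p x)
    (hμ : ∀ p w, ∑ x, (if g x = w then μ p x else 0) = δ) (hδ : Fintype.card W * δ = 1)
    [DecidablePred fun k : P → X => Function.Injective fun p => g (k p)] :
    ∑ k : P → X, (if Function.Injective (fun p => g (k p)) then 0 else ∏ i, μ i (k i)) ≤
      (Fintype.card P : ℝ) ^ 2 * δ := by
  have hδ0 : 0 ≤ δ := by
    by_contra! h
    have : (Fintype.card W : ℝ) * δ ≤ 0 := mul_nonpos_of_nonneg_of_nonpos (by positivity) h.le
    linarith
  have hprod : ∀ k : P → X, 0 ≤ ∏ i, μ i (k i) := fun k =>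
    Finset.prod_nonneg fun i _ => hnn i _
  have hle : ∀ k : P → X,
      (if Function.Injective (fun p => g (k p)) then 0 else ∏ i, μ i (k i)) ≤
      ∑ p, ∑ q, (if p ≠ q then (if g (k p) = g (k q) then ∏ i, μ i (k i) else 0) else 0) := by
    intro k
    have hterm : ∀ p q, 0 ≤
        (if p ≠ q then (if g (k p) = g (k q) then ∏ i, μ i (k i) else 0) else 0) := by
      intro p q
      split_ifs <;> first | exact le_rfl | exact hprod k
    split_ifs with hinj
    · exact Finset.sum_nonneg fun p _ => Finset.sum_nonneg fun q _ => hterm p q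
    · simp only [Function.Injective, not_forall] at hinj
      obtain ⟨p, q, hg, hpq⟩ := hinj
      calc ∏ i, μ i (k i)
          = (if p ≠ q then (if g (k p) = g (k q) then ∏ i, μ i (k i) else 0) else 0) := by
            rw [if_pos hpq, if_pos hg]
        _ ≤ ∑ q, (if p ≠ q then (if g (k p) = g (k q) then ∏ i, μ i (k i) else 0) else 0) :=
            Finset.single_le_sum (f := fun q =>
              (if p ≠ q then (if g (k p) = g (k q) then ∏ i, μ i (k i) else 0) else 0))
              (fun q _ => hterm p q) (Finset.mem_univ q)
        _ ≤ _ := Finset.single_le_sum (f := fun p => ∑ q,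
              (if p ≠ q then (if g (k p) = g (k q) then ∏ i, μ i (k i) else 0) else 0))
              (fun p _ => Finset.sum_nonneg fun q _ => hterm p q) (Finset.mem_univ p)
  refine (Finset.sum_le_sum fun k _ => hle k).trans ?_
  rw [Finset.sum_comm]
  have hpair : ∀ p q : P, ∑ k : P → X,
      (if p ≠ q then (if g (k p) = g (k q) then ∏ i, μ i (k i) else 0) else 0) ≤ δ := by
    intro p q
    by_cases hpq : p ≠ q
    · simp only [if_pos hpq]
      exact (sum_prod_collision g μ δ hμ hδ hpq).le
    · simpa only [if_neg hpq, Finset.sum_const_zero] using hδ0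
  calc _ = ∑ p : P, ∑ q : P, ∑ k : P → X,
        (if p ≠ q then (if g (k p) = g (k q) then ∏ i, μ i (k i) else 0) else 0) :=
        Finset.sum_congr rfl fun p _ => Finset.sum_comm
    _ ≤ ∑ _p : P, ∑ _q : P, δ :=
        Finset.sum_le_sum fun p _ => Finset.sum_le_sum fun q _ => hpair p q
    _ = _ := by simp; ring

/-! ### Averaged copy states -/

/-- The tuple of all basis labels of the `a + b + c` registers. -/
def registerEquiv (n a b c : ℕ) :
    CopyBasis n a b c ≃ (Fin a ⊕ Fin b ⊕ Fin c → BitString n) :=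
  ((Equiv.refl _).prodCongr (Equiv.sumArrowEquivProdArrow _ _ _).symm).trans
    (Equiv.sumArrowEquivProdArrow _ _ _).symm

/-- Which of the three sets a register belongs to. -/
def registerLabel {a b c : ℕ} : Fin a ⊕ Fin b ⊕ Fin c → Fin 3 :=
  Sum.elim (fun _ => 0) (Sum.elim (fun _ => 1) (fun _ => 2))

theorem copiesState_maskedTriple {m : ℕ} (r : BitString m → Bool × Bool) (s : Bool)
    (a b c : ℕ) (k : CopyBasis (m + 2) a b c) :
    copiesState (maskedTriple r s) a b c k =
      ∏ p, subsetState (maskedSet r s (registerLabel p)) (registerEquiv _ a b c k p) := by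
  simp only [Fintype.prod_sum_type, copiesState, tensorProd, tensorPow, maskedTriple]
  rfl

/-- No two registers lie in the same block. -/
def BlocksDistinct {m a b c : ℕ} (k : CopyBasis (m + 2) a b c) : Prop :=
  Function.Injective fun p => blockIndex (registerEquiv _ a b c k p)

theorem sum_copiesState_correlation {m a b c : ℕ} {k k' : CopyBasis (m + 2) a b c}
    (hk : BlocksDistinct k) (hk' : BlocksDistinct k') :
    ∑ r : BitString m → Bool × Bool, star (copiesState (maskedTriple r false) a b c k) *
        copiesState (maskedTriple r false) a b c k' =
    ∑ r : BitString m → Bool × Bool, star (copiesState (maskedTriple r true) a b c k) *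
        copiesState (maskedTriple r true) a b c k' := by
  obtain ⟨d, hd⟩ := exists_mask_shift registerLabel _ _ hk hk'
  have hinv : Function.Involutive fun (r : BitString m → Bool × Bool) w =>
      ((r w).1 ^^ (d w).1, (r w).2 ^^ (d w).2) := by
    intro r
    funext w
    simp
  refine Fintype.sum_equiv (hinv.toPerm _) _ _ fun r => ?_
  -- Equal sizes give equal amplitudes, so only the supports need comparing.
  have hcard : ∀ l, (((maskedSet r false l).card : ℕ) : ℝ) =
      ((maskedSet (hinv.toPerm _ r) true l).card : ℕ) := fun l => by
    rw [card_maskedSet, card_maskedSet]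
  simp only [copiesState_maskedTriple]
  congr 1
  · congr 1
    refine Finset.prod_congr rfl fun p _ => ?_
    simp only [subsetState, hcard]
    exact if_congr (hd r p).1.symm rfl rfl
  · refine Finset.prod_congr rfl fun p _ => ?_
    simp only [subsetState, hcard]
    exact if_congr (hd r p).2.symm rfl rfl

open Classical in
theorem sum_normSq_copiesState_not_blocksDistinct {m : ℕ} (r : BitString m → Bool × Bool)
    (s : Bool) (a b c : ℕ) :
    ∑ k, (if BlocksDistinct k then 0 else
        Complex.normSq (copiesState (maskedTriple r s) a b c k)) ≤
      ((a : ℝ) + b + c) ^ 2 / 2 ^ m := by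
  have h := sum_prod_not_injective_le (P := Fin a ⊕ Fin b ⊕ Fin c) (blockIndex (m := m))
    (fun p x => Complex.normSq (subsetState (maskedSet r s (registerLabel p)) x)) (1 / 2 ^ m)
    (fun _ _ => Complex.normSq_nonneg _) ?_ ?_
  · rw [← (registerEquiv (m + 2) a b c).sum_comp] at h
    have hc : (Fintype.card (Fin a ⊕ Fin b ⊕ Fin c) : ℝ) = a + b + c := by
      simp; ring
    rw [hc, mul_one_div] at h
    refine le_trans (le_of_eq ?_) h
    refine Finset.sum_congr rfl fun k _ => ?_
    rw [copiesState_maskedTriple, map_prod]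
    exact if_congr Iff.rfl rfl rfl
  · intro p w
    have hv : ∀ x, Complex.normSq (subsetState (maskedSet r s (registerLabel p)) x) =
        if x ∈ maskedSet r s (registerLabel p) then 1 / (2 * 2 ^ m : ℝ) else 0 := by
      intro x
      unfold subsetState
      split_ifs
      · rw [Complex.normSq_ofReal, card_maskedSet, div_mul_div_comm, Real.mul_self_sqrt
          (by positivity), one_mul]
      · simp
    simp_rw [hv]
    rw [sum_maskedSet_block]
    field_simp
  · simp

/-! ### Acceptance probabilities and truncation -/

theorem acceptProb_eq_sum {ι : Type*} [Fintype ι] (E : Matrix ι ι ℂ) (ψ : ι → ℂ) :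
    acceptProb E ψ = (∑ i, ∑ j, E i j * (star (ψ i) * ψ j)).re := by
  unfold acceptProb
  congr 1
  simp only [dotProduct, Matrix.mulVec, Finset.mul_sum, Pi.star_apply]
  exact Finset.sum_congr rfl fun i _ => Finset.sum_congr rfl fun j _ => by ring

theorem sum_acceptProb {ι R : Type*} [Fintype ι] [Fintype R] (E : Matrix ι ι ℂ)
    (ψ : R → ι → ℂ) :
    ∑ r, acceptProb E (ψ r) = (∑ i, ∑ j, E i j * ∑ r, star (ψ r i) * ψ r j).re := by
  simp_rw [acceptProb_eq_sum, ← Complex.re_sum, Finset.mul_sum]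
  rw [Finset.sum_comm]
  congr 1
  exact Finset.sum_congr rfl fun i _ => Finset.sum_comm

theorem acceptProb_nonneg {ι : Type*} [Fintype ι] [DecidableEq ι] {E : Matrix ι ι ℂ}
    (hE : E.PosSemidef) (ψ : ι → ℂ) : 0 ≤ acceptProb E ψ :=
  (Complex.le_def.1 (hE.dotProduct_mulVec_nonneg ψ)).1

theorem acceptProb_le {ι : Type*} [Fintype ι] [DecidableEq ι] {E : Matrix ι ι ℂ}
    (hE : IsEffect E) (ψ : ι → ℂ) : acceptProb E ψ ≤ ∑ i, Complex.normSq (ψ i) := by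
  have h := acceptProb_nonneg hE.compl_posSemidef ψ
  have h₁ : acceptProb (1 - E) ψ = ∑ i, Complex.normSq (ψ i) - acceptProb E ψ := by
    unfold acceptProb
    rw [Matrix.sub_mulVec, Matrix.one_mulVec, dotProduct_sub, Complex.sub_re]
    congr 1
    simp only [dotProduct, Complex.re_sum, Pi.star_apply]
    refine Finset.sum_congr rfl fun i _ => ?_
    simp [Complex.normSq_apply]
  linarith

/-- Expand the nonnegative form at `φ - 4χ`. The weight 4 keeps the factor on `φ` near 1, so that
applying the bound twice still separates 1/3 from 2/3. -/
theorem acceptProb_add_le {ι : Type*} [Fintype ι] [DecidableEq ι] {E : Matrix ι ι ℂ}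
    (hE : E.PosSemidef) (φ χ : ι → ℂ) :
    acceptProb E (φ + χ) ≤ 5 / 4 * acceptProb E φ + 5 * acceptProb E χ := by
  have h := acceptProb_nonneg hE (φ - (4 : ℝ) • χ)
  have key : acceptProb E (φ - (4 : ℝ) • χ) =
      5 * acceptProb E φ + 20 * acceptProb E χ - 4 * acceptProb E (φ + χ) := by
    simp only [acceptProb_eq_sum, Complex.re_sum, Finset.mul_sum, ← Finset.sum_add_distrib,
      ← Finset.sum_sub_distrib]
    refine Finset.sum_congr rfl fun i _ => Finset.sum_congr rfl fun j _ => ?_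
    simp
    ring
  linarith

/-- The part of a state on tuples in pairwise distinct blocks. -/
noncomputable def distinctPart {m a b c : ℕ} (ψ : CopyBasis (m + 2) a b c → ℂ) :
    CopyBasis (m + 2) a b c → ℂ :=
  open Classical in fun k => if BlocksDistinct k then ψ k else 0

theorem sum_acceptProb_distinctPart {m a b c : ℕ}
    (E : Matrix (CopyBasis (m + 2) a b c) (CopyBasis (m + 2) a b c) ℂ) :
    ∑ r : BitString m → Bool × Bool,
        acceptProb E (distinctPart (copiesState (maskedTriple r false) a b c)) =
    ∑ r : BitString m → Bool × Bool,
        acceptProb E (distinctPart (copiesState (maskedTriple r true) a b c)) := by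
  rw [sum_acceptProb, sum_acceptProb]
  refine congrArg Complex.re (Finset.sum_congr rfl fun k _ => Finset.sum_congr rfl fun k' _ =>
    congrArg (E k k' * ·) ?_)
  by_cases hk : BlocksDistinct k
  · by_cases hk' : BlocksDistinct k'
    · simpa only [distinctPart, if_pos hk, if_pos hk'] using sum_copiesState_correlation hk hk'
    · simp [distinctPart, if_neg hk']
  · simp [distinctPart, if_neg hk]

theorem acceptProb_sub_distinctPart_le {m : ℕ} (r : BitString m → Bool × Bool)
    (s : Bool) (a b c : ℕ)
    {E : Matrix (CopyBasis (m + 2) a b c) (CopyBasis (m + 2) a b c) ℂ} (hE : IsEffect E) :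
    acceptProb E (copiesState (maskedTriple r s) a b c -
        distinctPart (copiesState (maskedTriple r s) a b c)) ≤
      ((a : ℝ) + b + c) ^ 2 / 2 ^ m := by
  classical
  refine (acceptProb_le hE _).trans ?_
  refine le_trans (le_of_eq ?_) (sum_normSq_copiesState_not_blocksDistinct r s a b c)
  refine Finset.sum_congr rfl fun k _ => ?_
  by_cases hk : BlocksDistinct k <;> simp [distinctPart, hk]

theorem acceptProb_neg {ι : Type*} [Fintype ι] (E : Matrix ι ι ℂ) (ψ : ι → ℂ) :
    acceptProb E (-ψ) = acceptProb E ψ := by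
  simp [acceptProb, Matrix.mulVec_neg]

/-! ### The lower bound -/

theorem copies_lower_bound {m a b c : ℕ} (h : DistinguishableFromCopies
      (Set.range fun r : BitString m → Bool × Bool => maskedTriple r false)
      (Set.range fun r => maskedTriple r true) a b c) :
    (1 : ℝ) / 90 ≤ ((a : ℝ) + b + c) ^ 2 / 2 ^ m := by
  obtain ⟨E, hE, h₀, h₁⟩ := h
  set ε := ((a : ℝ) + b + c) ^ 2 / 2 ^ m with hε
  have hr : ∀ r : BitString m → Bool × Bool,
      2 / 3 ≤ 5 / 4 * acceptProb E (distinctPart (copiesState (maskedTriple r false) a b c)) +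
        5 * ε := by
    intro r
    have h₂ := h₀ _ ⟨r, rfl⟩
    have h₃ := acceptProb_add_le hE.posSemidef
      (distinctPart (copiesState (maskedTriple r false) a b c))
      (copiesState (maskedTriple r false) a b c -
        distinctPart (copiesState (maskedTriple r false) a b c))
    rw [add_sub_cancel] at h₃
    have := acceptProb_sub_distinctPart_le r false a b c hE
    linarith
  have hr' : ∀ r : BitString m → Bool × Bool,
      acceptProb E (distinctPart (copiesState (maskedTriple r true) a b c)) ≤
        5 / 12 + 5 * ε := by
    intro r
    have h₂ := h₁ _ ⟨r, rfl⟩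
    have h₃ := acceptProb_add_le hE.posSemidef
      (copiesState (maskedTriple r true) a b c)
      (-(copiesState (maskedTriple r true) a b c -
        distinctPart (copiesState (maskedTriple r true) a b c)))
    rw [← sub_eq_add_neg, sub_sub_cancel, acceptProb_neg] at h₃
    have := acceptProb_sub_distinctPart_le r true a b c hE
    linarith
  have hsum := Finset.sum_le_sum fun (r : BitString m → Bool × Bool)
    (_ : r ∈ Finset.univ) => hr r
  have hsum' := Finset.sum_le_sum fun (r : BitString m → Bool × Bool)
    (_ : r ∈ Finset.univ) => hr' r
  rw [Finset.sum_add_distrib, ← Finset.mul_sum, sum_acceptProb_distinctPart] at hsum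
  simp only [Finset.sum_const, nsmul_eq_mul] at hsum hsum'
  have hpos : (0 : ℝ) < (Finset.univ : Finset (BitString m → Bool × Bool)).card := by
    exact_mod_cast Finset.card_pos.2 Finset.univ_nonempty
  -- Averaging gives `2/3 ≤ 5/4 * (5/12 + 5ε) + 5ε`, that is `ε ≥ 7/540 > 1/90`.
  nlinarith

theorem not_distinguishable_zero_copies {n : ℕ} {S₀ S₁ : Set (SetTriple n)}
    (h₀ : S₀.Nonempty) (h₁ : S₁.Nonempty) : ¬ DistinguishableFromCopies S₀ S₁ 0 0 0 := by
  rintro ⟨E, -, hE₀, hE₁⟩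
  obtain ⟨T, hT⟩ := h₀
  obtain ⟨T', hT'⟩ := h₁
  have h := hE₀ T hT
  have h' := hE₁ T' hT'
  have : copiesState T 0 0 0 = copiesState T' 0 0 0 := by
    funext k
    simp [copiesState, tensorProd, tensorPow]
  rw [this] at h
  linarith

theorem mainTheorem8 :
    ∃ (S₀ S₁ : (n : ℕ) → Set (SetTriple n)) (κ : ℝ), 0 < κ ∧
      ∀ n : ℕ, 1 ≤ n →
        (S₀ n).Nonempty ∧ (S₁ n).Nonempty ∧
        (∀ T ∈ S₀ n ∪ S₁ n, T.1.Nonempty ∧ T.2.1.Nonempty ∧ T.2.2.Nonempty) ∧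
        (∀ T ∈ S₀ n, 1 / 16 ≤ tripleIntersectionDensity T) ∧
        (∀ T ∈ S₁ n, tripleIntersectionDensity T = 0) ∧
        ∀ a b c : ℕ, DistinguishableFromCopies (S₀ n) (S₁ n) a b c →
          κ * (2 : ℝ) ^ ((n : ℝ) / 2) ≤ (max a (max b c) : ℕ) := by
  suffices H : ∀ n : ℕ, ∃ S₀ S₁ : Set (SetTriple n), 1 ≤ n →
        S₀.Nonempty ∧ S₁.Nonempty ∧
        (∀ T ∈ S₀ ∪ S₁, T.1.Nonempty ∧ T.2.1.Nonempty ∧ T.2.2.Nonempty) ∧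
        (∀ T ∈ S₀, 1 / 16 ≤ tripleIntersectionDensity T) ∧
        (∀ T ∈ S₁, tripleIntersectionDensity T = 0) ∧
        ∀ a b c : ℕ, DistinguishableFromCopies S₀ S₁ a b c →
          1 / 100 * (2 : ℝ) ^ ((n : ℝ) / 2) ≤ (max a (max b c) : ℕ) by
    choose S₀ S₁ hS using H
    exact ⟨S₀, S₁, 1 / 100, by norm_num, hS⟩
  rintro (_ | _ | m)
  · exact ⟨∅, ∅, by simp⟩
  -- Blocks need two bits, so `n = 1` is separate: the required bound is below 1, and one copy is
  -- needed anyway.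
  · let x : BitString 1 := fun _ => false
    let y : BitString 1 := fun _ => true
    have hxy : x ≠ y := fun h => by simpa [x, y] using congrFun h 0
    refine ⟨{({x}, {x}, {x})}, {({x}, {x}, {y})}, fun _ => ⟨by simp, by simp, ?_, ?_, ?_, ?_⟩⟩
    · rintro T (rfl | rfl) <;> simp
    · rintro T rfl
      norm_num [tripleIntersectionDensity]
    · rintro T rfl
      simp [tripleIntersectionDensity, hxy.symm]
    · intro a b c h
      have hmax : 1 ≤ max a (max b c) := by
        by_contra! h0
        obtain ⟨rfl, rfl, rfl⟩ : a = 0 ∧ b = 0 ∧ c = 0 := by omega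
        exact not_distinguishable_zero_copies (by simp) (by simp) h
      have h1 : (1 : ℝ) ≤ (max a (max b c) : ℕ) := by exact_mod_cast hmax
      have h2 : (2 : ℝ) ^ (((0 + 1 : ℕ) : ℝ) / 2) ≤ 2 ^ (1 : ℝ) :=
        Real.rpow_le_rpow_of_exponent_le (by norm_num) (by norm_num)
      rw [Real.rpow_one] at h2
      linarith
  · refine ⟨Set.range fun r : BitString m → Bool × Bool => maskedTriple r false,
      Set.range fun r => maskedTriple r true,
      fun _ => ⟨Set.range_nonempty _, Set.range_nonempty _, ?_, ?_, ?_, ?_⟩⟩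
    · rintro T (⟨r, rfl⟩ | ⟨r, rfl⟩) <;>
        exact ⟨maskedSet_nonempty _ _ _, maskedSet_nonempty _ _ _, maskedSet_nonempty _ _ _⟩
    · rintro T ⟨r, rfl⟩
      norm_num [density_maskedTriple_false]
    · rintro T ⟨r, rfl⟩
      exact density_maskedTriple_true r
    · intro a b c h
      have hb := copies_lower_bound h
      set t := max a (max b c) with ht
      have ha : (a : ℝ) ≤ t := by exact_mod_cast le_max_left _ _
      have hb' : (b : ℝ) ≤ t := by
        exact_mod_cast (le_max_left _ _).trans (le_max_right _ _)
      have hc : (c : ℝ) ≤ t := by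
        exact_mod_cast (le_max_right _ _).trans (le_max_right _ _)
      rw [le_div_iff₀ (by positivity)] at hb
      have hsq : ((a : ℝ) + b + c) ^ 2 ≤ (3 * t) ^ 2 :=
        pow_le_pow_left₀ (by positivity) (by linarith) 2
      have hpow : ((2 : ℝ) ^ (((m + 1 + 1 : ℕ) : ℝ) / 2)) ^ 2 = 2 ^ m * 4 := by
        rw [← Real.rpow_natCast, ← Real.rpow_mul (by norm_num), Nat.cast_two,
          div_mul_cancel₀ _ (by norm_num), Real.rpow_natCast]
        ring
      refine le_of_sq_le_sq ?_ (by positivity)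
      rw [mul_pow, hpow]
      have : (0 : ℝ) < 2 ^ m := by positivity
      -- `9t^2 ≥ 2^m / 90` exceeds what is needed, `t^2 ≥ 4 * 2^m / 100^2`.
      nlinarith
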